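/- Let $K$ be a field and $S=K[x_{12},x_{14},x_{15},x_{23},x_{26},x_{34},x_{37},x_{48},x_{56},x_{58},x_{67},x_{78}]$, with one variable for each edge of the cube graph on the vertices $1,\dots,8$ (edges $12,14,15,23,26,34,37,48,56,58,67,78$). Definitions. A grading of $S$ is given by an abelian group $\mathcal H$ with a distinguished family of generators $\mathbf h_{ij}$, one for each variable, $\mathbf h_{ij}$ being the degree of $x_{ij}$. A polynomial is $\mathcal H$-homogeneous if all its monomials have the same degree, and an ideal is $\mathcal H$-homogeneous if it is generated by $\mathcal H$-homogeneous polynomials. Write $\mathcal F\le\mathcal H$ ($\mathcal F$ is a specialization of $\mathcal H$) if every $\mathcal H$-homogeneous ideal of $S$ is $\mathcal F$-homogeneous; two gradings are equivalent if they have the same homogeneous ideals. For an ideal $J$, $\mathrm{ara}_{\mathcal H}(J)$ is the smallest $s$ such that $\mathrm{rad}(J)=\mathrm{rad}(F_1,\dots,F_s)$ for some $\mathcal H$-homogeneous $F_1,\dots,F_s\in S$, and $J$ is an $\mathcal H$-homogeneous set-theoretic complete intersection if $\mathrm{ht}(J)=\mathrm{ara}_{\mathcal H}(J)$. Let $\mathcal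 G=\mathbb ZA$ be the subgroup of $\mathbb Z^8$ generated by $\mathbf a_{ij}=\mathbf e_i+\mathbf e_j$, $ij$ an edge, and let $\mathcal F=\mathbb ZB$ be the subgroup of $\mathbb Z^4$ generated by $\mathbf b_{12}=(5,0,3,4)$, $\mathbf b_{14}=(3,1,5,5)$, $\mathbf b_{15}=(4,1,4,8)$, $\mathbf b_{23}=(4,0,2,3)$, $\mathbf b_{26}=(5,0,1,6)$, $\mathbf b_{34}=(2,1,4,4)$, $\mathbf b_{37}=(2,1,2,6)$, $\mathbf b_{48}=(1,2,5,8)$, $\mathbf b_{56}=(4,1,2,10)$, $\mathbf b_{58}=(2,2,4,11)$, $\mathbf b_{67}=(3,1,1,9)$, $\mathbf b_{78}=(1,2,3,10)$, each with the listed generators. Let $L_{\mathcal G}=\{u\in\mathbb Z^{12}:\sum u_{ij}\mathbf a_{ij}=\mathbf 0\}$ and let $I=(x^{\alpha_+}-x^{\alpha_-}:\alpha\in L_{\mathcal G})\subset S$, where $\alpha_+$ and $\alpha_-$ are the positive and negative parts of $\alpha$. Then $I$ is prime, $I$ is the kernel of the $K$-algebra homomorphism $S\to K[t_1,\dots,t_8]$,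 $x_{ij}\mapsto t_it_j$ (the toric ideal of the cube graph), $\mathcal F\le\mathcal G$, and $$\mathrm{ara}_{\mathcal G}(I)=10,\qquad \mathrm{ara}_{\mathcal F}(I)=7,\qquad \mathrm{ht}(I)=5.$$ For every grading $\mathcal H$ with $\mathcal F\le\mathcal H\le\mathcal G$ one has $7\le\mathrm{ara}_{\mathcal H}(I)\le 10$, and $I$ is not an $\mathcal H$-homogeneous set-theoretic complete intersection. There are infinitely many equivalence classes of gradings $\mathcal H$ with $\mathcal F\le\mathcal H\le\mathcal G$. -/

import Mathlib

universe u v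

/-- A grading datum on `K[x_i : i ∈ σ]`: an abelian group together with a distinguished family of
generators indexed by the variables (`gen i` is the degree of `x_i`). -/
structure Grading (σ : Type) where
  carrier : Type u
  [addCommGroup : AddCommGroup carrier]
  gen : σ → carrier
  closure_range_gen : AddSubgroup.closure (Set.range gen) = ⊤

attribute [instance] Grading.addCommGroup

namespace Grading

variable {σ : Type}

/-- The lattice `ℤB` spanned by a family of vectors `b`, with the vectors as its generators. -/
def ofVectors {M : Type u} [AddCommGroup M] (b : σ → M) : Grading.{u} σ where
  carrier := AddSubgroup.closure (Set.range b)
  gen i := ⟨b i, AddSubgroup.subset_closure ⟨i, rfl⟩⟩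
  closure_range_gen := by
    rw [← AddSubgroup.closure_closure_coe_preimage (k := Set.range b)]
    congr 1
    ext ⟨x, hx⟩
    simp [Subtype.ext_iff]

/-- The degree map `ℤ^σ → 𝓖`, `u ↦ ∑ u_i g_i`. -/
def deg [Fintype σ] (G : Grading.{u} σ) : (σ → ℤ) →+ G.carrier where
  toFun c := ∑ i, c i • G.gen i
  map_zero' := by simp
  map_add' c d := by simp [add_smul, Finset.sum_add_distrib]

/-- The lattice `L_𝓖` of relations of the generators. -/
def relLattice [Fintype σ] (G : Grading.{u} σ) : AddSubgroup (σ → ℤ) := G.deg.ker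

section

variable {K : Type v} [Field K]

/-- `p` is `𝓖`-homogeneous: all its monomials have the same `𝓖`-degree. -/
def IsHomogeneous (G : Grading.{u} σ) (p : MvPolynomial σ K) : Prop :=
  ∃ d : G.carrier, MvPolynomial.IsWeightedHomogeneous G.gen p d

/-- `J` is `𝓖`-homogeneous: it is generated by `𝓖`-homogeneous polynomials. -/
def IsHomogeneousIdeal (G : Grading.{u} σ) (J : Ideal (MvPolynomial σ K)) : Prop :=
  ∃ S : Set (MvPolynomial σ K), (∀ p ∈ S, G.IsHomogeneous p) ∧ Ideal.span S = J

/-- The `𝓖`-homogeneous arithmetical rank: the smallest `s` such that `rad J = rad (F_1, …, F_s)`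
for some `𝓖`-homogeneous polynomials `F_1, …, F_s` (and `⊤` if there is no such `s`). -/
noncomputable def ara (G : Grading.{u} σ) (J : Ideal (MvPolynomial σ K)) : ℕ∞ :=
  sInf {s : ℕ∞ | ∃ (n : ℕ) (F : Fin n → MvPolynomial σ K), s = n ∧
    (∀ i, G.IsHomogeneous (F i)) ∧ J.radical = (Ideal.span (Set.range F)).radical}

/-- `J` is a `𝓖`-homogeneous set-theoretic complete intersection. -/
def IsSetTheoreticCI (G : Grading.{u} σ) (J : Ideal (MvPolynomial σ K)) : Prop :=
  J.height = G.ara J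

end

universe u₁ u₂

/-- `𝓕 ≤ 𝓖`: every `𝓖`-homogeneous ideal of `K[x]` is `𝓕`-homogeneous. -/
def IsSpecialization (K : Type v) [Field K] (F : Grading.{u₁} σ) (G : Grading.{u₂} σ) : Prop :=
  ∀ J : Ideal (MvPolynomial σ K), G.IsHomogeneousIdeal J → F.IsHomogeneousIdeal J

/-- Equivalence of gradings, `𝓕 ∼ 𝓖`: they have the same homogeneous ideals in `K[x]`. -/
def equivalence (K : Type v) [Field K] (σ : Type) : Setoid (Grading.{u} σ) where
  r F G := ∀ J : Ideal (MvPolynomial σ K), F.IsHomogeneousIdeal J ↔ G.IsHomogeneousIdeal J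
  iseqv := ⟨fun _ _ => Iff.rfl, fun h J => (h J).symm, fun h h' J => (h J).trans (h' J)⟩

end Grading

/-- The lattice ideal `I_L = (x^{α₊} - x^{α₋} : α ∈ L)` of a lattice `L ⊆ ℤ^σ`. -/
noncomputable def latticeIdeal (K : Type v) [Field K] {σ : Type} [Fintype σ]
    (L : AddSubgroup (σ → ℤ)) : Ideal (MvPolynomial σ K) :=
  Ideal.span {p | ∃ α ∈ L,
    p = MvPolynomial.monomial (Finsupp.equivFunOnFinite.symm fun i => (α i).toNat) 1 -
      MvPolynomial.monomial (Finsupp.equivFunOnFinite.symm fun i => (-α i).toNat) 1}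

/-- The twelve edges of the cube graph with vertices `1, …, 8`: the top square `1-2-3-4`, the
bottom square `5-6-7-8` and the vertical edges `15, 26, 37, 48`. -/
inductive CubeEdge
  | e12 | e14 | e15 | e23 | e26 | e34 | e37 | e48 | e56 | e58 | e67 | e78
  deriving DecidableEq

namespace CubeEdge

instance : Fintype CubeEdge where
  elems := {e12, e14, e15, e23, e26, e34, e37, e48, e56, e58, e67, e78}
  complete e := by cases e <;> simp

/-- The endpoints of an edge; the vertices `1, …, 8` are written `0, …, 7`. -/
def ends : CubeEdge → Fin 8 × Fin 8
  | e12 => (0, 1)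
  | e14 => (0, 3)
  | e15 => (0, 4)
  | e23 => (1, 2)
  | e26 => (1, 5)
  | e34 => (2, 3)
  | e37 => (2, 6)
  | e48 => (3, 7)
  | e56 => (4, 5)
  | e58 => (4, 7)
  | e67 => (5, 6)
  | e78 => (6, 7)

/-- The vector configuration of the cube graph: `a_{ij} = e_i + e_j` for each edge `ij`. -/
def aVec (e : CubeEdge) : Fin 8 → ℤ := Pi.single e.ends.1 1 + Pi.single e.ends.2 1

/-- The vectors `b_{ij}` of the coarser grading. -/
def bVec : CubeEdge → Fin 4 → ℤ
  | e12 => ![5, 0, 3, 4]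
  | e14 => ![3, 1, 5, 5]
  | e15 => ![4, 1, 4, 8]
  | e23 => ![4, 0, 2, 3]
  | e26 => ![5, 0, 1, 6]
  | e34 => ![2, 1, 4, 4]
  | e37 => ![2, 1, 2, 6]
  | e48 => ![1, 2, 5, 8]
  | e56 => ![4, 1, 2, 10]
  | e58 => ![2, 2, 4, 11]
  | e67 => ![3, 1, 1, 9]
  | e78 => ![1, 2, 3, 10]

end CubeEdge

/-- The group `𝓖 = ℤA_G` of the cube graph. -/
def cubeG : Grading.{0} CubeEdge := Grading.ofVectors CubeEdge.aVec

/-- The group `𝓕 = ℤB`. -/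
def cubeF : Grading.{0} CubeEdge := Grading.ofVectors CubeEdge.bVec

/-- The toric ideal of the cube graph, as the lattice ideal of `L_𝓖`. -/
noncomputable def cubeIdeal (K : Type v) [Field K] : Ideal (MvPolynomial CubeEdge K) :=
  latticeIdeal K cubeG.relLattice

/-- The `K`-algebra homomorphism `x_{ij} ↦ t_i t_j`. -/
noncomputable def cubeHom (K : Type v) [Field K] :
    MvPolynomial CubeEdge K →ₐ[K] MvPolynomial (Fin 8) K :=
  MvPolynomial.aeval fun e => MvPolynomial.X e.ends.1 * MvPolynomial.X e.ends.2

/-!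
Exponents of equal degree form a congruence on `ℕ^σ`. Refining a grading means shrinking this
congruence, and a toric ideal is contained in an ideal `J` as soon as the congruence of its degrees
is contained in the congruence of the binomials in `J`.

The toric ideal of the cube is generated by the binomials of the six squares and four hexagons of
the cube. Indeed, if two monomials have the same vertex degrees, then following them from a vertex
where they have different edges, one finds squares or a hexagon with a perfect matching in one of
the monomials; exchanging this matching for the other one produces a common variable to cancel.

If `f` runs through generators of an ideal up to radical and `s` is minimal among the supports of
the monomials of elements of the ideal, then some `f` contains a monomial with support `s`: evaluate
the variables in `s` at `1` and the others at `0`. The first perfect matchings of the ten cycles are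
such supports. In the grading by `aVec` they have no degrees in common, which gives the lower bound
`10`; for `bVec` this remains true of the six squares, which span the facets of the cone of `bVec`,
and one hexagon, which gives `7`. Conversely the four hexagons have the same `bVec`-degree, and
modulo the squares the product of two distinct hexagon binomials vanishes, so that the sum of the
hexagons suffices.

Adding the degree at one vertex modulo `r` to the degree by `bVec` gives pairwise inequivalent
gradings for all `r`.
-/

open MvPolynomial
open Finsupp (single weight)

section Weight

variable {σ M N : Type*} [AddCommMonoid M] [AddCommMonoid N]

theorem map_weight (φ : M →+ N) (w : σ → M) (m : σ →₀ ℕ) :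
    φ (weight w m) = weight (fun i => φ (w i)) m := by
  simp [Finsupp.weight_apply, map_finsuppSum]

/-- The congruence on exponents that identifies monomials of the same degree, the variable `x_i`
having degree `w i`. -/
noncomputable def weightCon (w : σ → M) : AddCon (σ →₀ ℕ) :=
  AddCon.ker (weight w)

theorem weightCon_le_weightCon_map (φ : M →+ N) (w : σ → M) :
    weightCon w ≤ weightCon fun i => φ (w i) := by
  intro m n (h : weight w m = weight w n)
  change weight _ m = weight _ n
  rw [← map_weight, h, map_weight]

theorem weightCon_map_of_injective {φ : M →+ N} (hφ : Function.Injective φ) (w : σ → M) :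
    (weightCon fun i => φ (w i)) = weightCon w := by
  refine le_antisymm (fun m n h => hφ ?_) (weightCon_le_weightCon_map φ w)
  rw [map_weight, map_weight]
  exact h

theorem weight_prodMk (w : σ → M) (w' : σ → N) (m : σ →₀ ℕ) :
    weight (fun i => (w i, w' i)) m = (weight w m, weight w' m) :=
  Prod.ext (map_weight (AddMonoidHom.fst M N) _ m) (map_weight (AddMonoidHom.snd M N) _ m)

theorem weightCon_prodMk_iff {w : σ → M} {w' : σ → N} {m n : σ →₀ ℕ} :
    weightCon (fun i => (w i, w' i)) m n ↔ weightCon w m n ∧ weightCon w' m n := by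
  change weight _ m = weight _ n ↔ _
  rw [weight_prodMk, weight_prodMk, Prod.mk.injEq]
  rfl

theorem weight_eq_zero_iff_of_nonneg [LinearOrder N] [IsOrderedCancelAddMonoid N] {w : σ → N}
    (hw : ∀ i, 0 ≤ w i) {m : σ →₀ ℕ} : weight w m = 0 ↔ ∀ i ∈ m.support, w i = 0 := by
  rw [Finsupp.weight_apply, Finsupp.sum,
    Finset.sum_eq_zero_iff_of_nonneg fun i _ => nsmul_nonneg (hw i) _]
  refine forall₂_congr fun i hi => ?_
  rw [nsmul_eq_zero_iff, or_iff_left (Finsupp.mem_support_iff.1 hi)]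

/-- The monomials of a given degree have their supports in the same faces of the cone spanned by the
degrees of the variables. -/
theorem forall_mem_support_eq_zero_iff_of_weightCon {w : σ → M} {ℓ : M →+ ℤ}
    (hℓ : ∀ i, 0 ≤ ℓ (w i)) {m n : σ →₀ ℕ} (h : weightCon w m n) :
    (∀ i ∈ m.support, ℓ (w i) = 0) ↔ ∀ i ∈ n.support, ℓ (w i) = 0 := by
  rw [← weight_eq_zero_iff_of_nonneg hℓ, ← weight_eq_zero_iff_of_nonneg hℓ]
  rw [← map_weight, ← map_weight, show weight w m = weight w n from h]

end Weight

section ToricIdeal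

variable (K : Type*) {σ M : Type*} [CommRing K] [AddCommMonoid M]

/-- The homomorphism `x_i ↦ t ^ w i` to the semigroup algebra, with kernel `toricIdeal K w`. -/
noncomputable def monomialHom (w : σ → M) : MvPolynomial σ K →ₐ[K] AddMonoidAlgebra K M :=
  AddMonoidAlgebra.mapDomainAlgHom K K (weight w)

/-- The toric ideal of a family `w` of vectors. -/
noncomputable def toricIdeal (w : σ → M) : Ideal (MvPolynomial σ K) :=
  RingHom.ker (monomialHom K w)

/-- The congruence on exponents modulo `J`: two exponents are congruent if the difference of their
monomials belongs to `J`. -/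
def binomialCon {K : Type*} [CommRing K] (J : Ideal (MvPolynomial σ K)) : AddCon (σ →₀ ℕ) where
  r m n := monomial m 1 - monomial n 1 ∈ J
  iseqv :=
    { refl m := by simp
      symm h := by simpa using J.neg_mem h
      trans h h' := by simpa using J.add_mem h h' }
  add' {m n m' n'} h h' := by
    have := J.add_mem (J.mul_mem_right (monomial m' 1) h) (J.mul_mem_left (monomial n 1) h')
    simpa only [sub_mul, mul_sub, monomial_mul, one_mul, sub_add_sub_cancel] using this

theorem monomialHom_monomial (w : σ → M) (m : σ →₀ ℕ) (c : K) :
    monomialHom K w (monomial m c) = AddMonoidAlgebra.single (weight w m) c :=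
  AddMonoidAlgebra.mapDomain_single

theorem monomialHom_X (w : σ → M) (i : σ) :
    monomialHom K w (X i) = AddMonoidAlgebra.single (w i) 1 := by
  rw [X, monomialHom_monomial, Finsupp.weight_single, one_smul]

variable {K}

theorem binomialCon_toricIdeal [Nontrivial K] (w : σ → M) :
    binomialCon (toricIdeal K w) = weightCon w := by
  ext m n
  change monomial m 1 - monomial n 1 ∈ toricIdeal K w ↔ weight w m = weight w n
  rw [toricIdeal, RingHom.mem_ker, map_sub, sub_eq_zero, monomialHom_monomial,
    monomialHom_monomial]
  exact (AddMonoidAlgebra.single_left_injective one_ne_zero).eq_iff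

/-- Modulo `J`, a polynomial is determined by its image under `monomialHom`, since every monomial is
congruent to a chosen one of the same degree. -/
theorem sub_mapDomain_invFun_weight_mem {w : σ → M} {J : Ideal (MvPolynomial σ K)}
    (h : weightCon w ≤ binomialCon J) (p : MvPolynomial σ K) :
    p - AddMonoidAlgebra.mapDomain (Function.invFun (weight w)) (monomialHom K w p) ∈ J := by
  induction p using MvPolynomial.induction_on' with
  | monomial m c =>
    rw [monomialHom_monomial, AddMonoidAlgebra.mapDomain_single]
    have := J.mul_mem_left (C c) (h (x := m) (y := Function.invFun (weight w) (weight w m))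
      (Function.invFun_eq ⟨m, rfl⟩).symm)
    rwa [mul_sub, C_mul_monomial, C_mul_monomial, mul_one] at this
  | add p q hp hq =>
    rw [map_add, AddMonoidAlgebra.mapDomain_add, add_sub_add_comm]
    exact J.add_mem hp hq

theorem toricIdeal_le_iff [Nontrivial K] {w : σ → M} {J : Ideal (MvPolynomial σ K)} :
    toricIdeal K w ≤ J ↔ weightCon w ≤ binomialCon J := by
  refine ⟨fun h m n hmn => h ?_, fun h p hp => ?_⟩
  · rw [← binomialCon_toricIdeal (K := K)] at hmn
    exact hmn
  · have := sub_mapDomain_invFun_weight_mem h p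
    rwa [(show monomialHom K w p = 0 from hp), AddMonoidAlgebra.mapDomain_zero, sub_zero] at this

theorem toricIdeal_le_toricIdeal_iff [Nontrivial K] {N : Type*} [AddCommMonoid N] {w : σ → M}
    {w' : σ → N} : toricIdeal K w ≤ toricIdeal K w' ↔ weightCon w ≤ weightCon w' := by
  rw [toricIdeal_le_iff, binomialCon_toricIdeal]

theorem toricIdeal_eq_toricIdeal_iff [Nontrivial K] {N : Type*} [AddCommMonoid N] {w : σ → M}
    {w' : σ → N} : toricIdeal K w = toricIdeal K w' ↔ weightCon w = weightCon w' := by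
  simp only [le_antisymm_iff, toricIdeal_le_toricIdeal_iff]

instance toricIdeal_isPrime [IsDomain K] [UniqueSums M] (w : σ → M) : (toricIdeal K w).IsPrime :=
  RingHom.ker_isPrime _

end ToricIdeal

namespace Grading

universe u₁ u₂

variable {σ : Type} {K : Type v} [Field K]

theorem weightCon_ofVectors {M : Type u} [AddCommGroup M] (b : σ → M) :
    weightCon (ofVectors b).gen = weightCon b :=
  (weightCon_map_of_injective (φ := (AddSubgroup.closure (Set.range b)).subtype)
    Subtype.val_injective (ofVectors b).gen).symm

theorem sub_mem_relLattice_iff [Fintype σ] {G : Grading.{u} σ} {m n : σ →₀ ℕ} :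
    (fun i => (m i : ℤ) - n i) ∈ G.relLattice ↔ weightCon G.gen m n := by
  have hdeg (m : σ →₀ ℕ) : G.deg (fun i => (m i : ℤ)) = weight G.gen m := by
    simp [deg, Finsupp.weight_apply, Finsupp.sum_fintype]
  change G.deg ((fun i => (m i : ℤ)) - fun i => (n i : ℤ)) = 0 ↔ weight G.gen m = weight G.gen n
  rw [map_sub, hdeg, hdeg, sub_eq_zero]

theorem latticeIdeal_relLattice [Fintype σ] (G : Grading.{u} σ) :
    latticeIdeal K G.relLattice = toricIdeal K G.gen := by
  apply le_antisymm
  · refine Ideal.span_le.2 ?_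
    rintro _ ⟨α, hα, rfl⟩
    change binomialCon (toricIdeal K G.gen) _ _
    rw [binomialCon_toricIdeal, ← sub_mem_relLattice_iff]
    convert hα using 2 with i
    exact Int.toNat_sub_toNat_neg (α i)
  · refine toricIdeal_le_iff.2 fun m n h => ?_
    set J := latticeIdeal K G.relLattice
    let α (i : σ) : ℤ := m i - n i
    have key : binomialCon J (Finsupp.equivFunOnFinite.symm fun i => (α i).toNat)
        (Finsupp.equivFunOnFinite.symm fun i => (-α i).toNat) :=
      Ideal.subset_span ⟨α, sub_mem_relLattice_iff.2 h, rfl⟩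
    convert (binomialCon J).add ((binomialCon J).refl (m ⊓ n)) key using 1 <;> ext i <;>
      simp [α] <;> omega

theorem isHomogeneous_monomial_sub_monomial {G : Grading.{u} σ} {m n : σ →₀ ℕ}
    (h : weightCon G.gen m n) : G.IsHomogeneous (monomial m (1 : K) - monomial n 1) :=
  ⟨weight G.gen m, (isWeightedHomogeneous_monomial _ _ _ rfl).sub
    (isWeightedHomogeneous_monomial _ _ _ h.symm)⟩

theorem IsHomogeneous.weightCon_of_mem_support {G : Grading.{u} σ} {p : MvPolynomial σ K}
    (hp : G.IsHomogeneous p) {m n : σ →₀ ℕ} (hm : m ∈ p.support) (hn : n ∈ p.support) :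
    weightCon G.gen m n := by
  obtain ⟨d, hd⟩ := hp
  exact (hd (mem_support_iff.1 hm)).trans (hd (mem_support_iff.1 hn)).symm

theorem IsHomogeneous.of_weightCon_le {F : Grading.{u₁} σ} {G : Grading.{u₂} σ}
    (h : weightCon G.gen ≤ weightCon F.gen) {p : MvPolynomial σ K}
    (hp : G.IsHomogeneous p) : F.IsHomogeneous p := by
  rcases p.support.eq_empty_or_nonempty with h0 | ⟨m, hm⟩
  · rw [support_eq_empty.1 h0]
    exact ⟨0, isWeightedHomogeneous_zero _ _ _⟩
  · exact ⟨weight F.gen m, fun n hn => h (hp.weightCon_of_mem_support (mem_support_iff.2 hn) hm)⟩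

attribute [local instance] MvPolynomial.weightedGradedAlgebra

open scoped Classical in
theorem IsHomogeneousIdeal.weightedHomogeneousComponent_mem {G : Grading.{u} σ}
    {J : Ideal (MvPolynomial σ K)} (hJ : G.IsHomogeneousIdeal J) {p : MvPolynomial σ K}
    (hp : p ∈ J) (d : G.carrier) : weightedHomogeneousComponent G.gen d p ∈ J := by
  obtain ⟨S, hS, rfl⟩ := hJ
  exact weightedHomogeneousComponent_mem_of_mem K G.gen
    (Ideal.homogeneous_span _ _ fun p hp => hS p hp) hp d

theorem isSpecialization_iff {F : Grading.{u₁} σ} {G : Grading.{u₂} σ} :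
    IsSpecialization K F G ↔ weightCon G.gen ≤ weightCon F.gen := by
  classical
  constructor
  · intro h m n hmn
    by_contra hne
    have hJ := h (Ideal.span {monomial m (1 : K) - monomial n 1})
      ⟨_, by simpa using isHomogeneous_monomial_sub_monomial hmn, rfl⟩
    -- The monomial `x^m` would be a multiple of `x^m - x^n`, which vanishes at `(1, …, 1)`.
    have hmem := hJ.weightedHomogeneousComponent_mem (Ideal.mem_span_singleton_self _)
      (weight F.gen m)
    rw [map_sub, (isWeightedHomogeneous_monomial F.gen m (1 : K)
      rfl).weightedHomogeneousComponent_same, (isWeightedHomogeneous_monomial F.gen n (1 : K)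
      rfl).weightedHomogeneousComponent_ne _ hne, sub_zero] at hmem
    obtain ⟨q, hq⟩ := Ideal.mem_span_singleton.1 hmem
    simpa [eval_monomial] using congrArg (eval fun _ => (1 : K)) hq
  · rintro h J ⟨S, hS, rfl⟩
    exact ⟨S, fun p hp => (hS p hp).of_weightCon_le h, rfl⟩

theorem IsSpecialization.ara_le {F : Grading.{u₁} σ} {G : Grading.{u₂} σ}
    (h : IsSpecialization K F G) (J : Ideal (MvPolynomial σ K)) : F.ara J ≤ G.ara J := by
  refine sInf_le_sInf ?_
  rintro s ⟨n, f, hs, hf, hJ⟩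
  exact ⟨n, f, hs, fun i => (hf i).of_weightCon_le (isSpecialization_iff.1 h), hJ⟩

theorem ara_le_card {ι : Type*} [Fintype ι] {G : Grading.{u} σ} {J : Ideal (MvPolynomial σ K)}
    {f : ι → MvPolynomial σ K} (hf : ∀ i, G.IsHomogeneous (f i))
    (hJ : J.radical = (Ideal.span (Set.range f)).radical) : G.ara J ≤ Fintype.card ι := by
  let e := Fintype.equivFin ι
  refine sInf_le ⟨Fintype.card ι, f ∘ e.symm, rfl, fun i => hf _, ?_⟩
  rwa [e.symm.surjective.range_comp]

end Grading

section MonomialSupports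

variable {σ R : Type*} [CommRing R]

/-- The supports of the monomials that occur in the elements of `J`. The minimal ones have to occur
in every family of generators of `J`, even up to radical. -/
def monomialSupports (J : Ideal (MvPolynomial σ R)) : Set (Finset σ) :=
  {s | ∃ f ∈ J, ∃ m ∈ f.support, m.support = s}

theorem exists_support_eq_of_minimal_monomialSupports [IsDomain R] {ι : Type*}
    {J : Ideal (MvPolynomial σ R)} {s : Finset σ}
    (hs : Minimal (· ∈ monomialSupports J.radical) s) {f : ι → MvPolynomial σ R}
    (hf : J.radical = (Ideal.span (Set.range f)).radical) :
    ∃ i, ∃ m ∈ (f i).support, m.support = s := by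
  classical
  by_contra! hne
  let φ := killCompl (R := R) (Subtype.val_injective (p := (· ∈ s)))
  have hφ (i) : φ (f i) = 0 := by
    ext d
    rw [coeff_killCompl, coeff_zero]
    by_contra hd
    have hsub : (d.mapDomain Subtype.val).support ⊆ s := fun e he => by
      obtain ⟨x, -, rfl⟩ := Finset.mem_image.1 (Finsupp.mapDomain_support he)
      exact x.2
    have hfi : f i ∈ J.radical := hf ▸ Ideal.le_radical (Ideal.subset_span ⟨i, rfl⟩)
    exact hne i _ (mem_support_iff.2 hd)
      (hs.eq_of_le ⟨f i, hfi, _, mem_support_iff.2 hd, rfl⟩ hsub)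
  have hker : J.radical ≤ RingHom.ker φ := by
    rw [hf, (RingHom.ker_isPrime φ).isRadical.radical_le_iff, Ideal.span_le]
    rintro _ ⟨i, rfl⟩
    exact hφ i
  obtain ⟨p, hp, m, hm, rfl⟩ := hs.prop
  have hmap : (m.comapDomain _ Subtype.val_injective.injOn).mapDomain Subtype.val = m :=
    Finsupp.mapDomain_comapDomain _ Subtype.val_injective _ fun e he => ⟨⟨e, he⟩, rfl⟩
  refine mem_support_iff.1 hm ?_
  rw [← hmap, ← coeff_killCompl Subtype.val_injective, show killCompl _ p = 0 from hker hp,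
    coeff_zero]

/-- A polynomial of the given family that contains a monomial with minimal support `s i` determines
`i`, as all its monomials have the same degree. -/
theorem Grading.card_le_ara {σ : Type} {K : Type v} [Field K] {ι : Type*} [Fintype ι]
    {G : Grading.{u} σ} {J : Ideal (MvPolynomial σ K)} {s : ι → Finset σ}
    (hs : ∀ i, Minimal (· ∈ monomialSupports J.radical) (s i))
    (hsep : ∀ i j (m n : σ →₀ ℕ), m.support = s i → n.support = s j → weightCon G.gen m n →
      i = j) : Fintype.card ι ≤ G.ara J := by
  refine le_sInf ?_
  rintro _ ⟨k, f, rfl, hf, hJ⟩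
  choose g m hm hms using fun i => exists_support_eq_of_minimal_monomialSupports (hs i) hJ
  have hg : Function.Injective g := fun i j hij =>
    hsep i j _ _ (hms i) (hms j) ((hf (g i)).weightCon_of_mem_support (hm i) (hij ▸ hm j))
  simpa using Fintype.card_le_of_injective g hg

theorem exists_le_of_mem_span_monomial_sub_monomial {ι : Type*} {p q : ι → σ →₀ ℕ}
    {f : MvPolynomial σ R}
    (hf : f ∈ Ideal.span (Set.range fun i => monomial (p i) 1 - monomial (q i) 1)) {m : σ →₀ ℕ}
    (hm : m ∈ f.support) : ∃ i, p i ≤ m ∨ q i ≤ m := by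
  let s := Set.range p ∪ Set.range q
  have hle : Ideal.span (Set.range fun i => monomial (p i) (1 : R) - monomial (q i) 1) ≤
      Ideal.span ((fun d => monomial d 1) '' s) := by
    rw [Ideal.span_le]
    rintro _ ⟨i, rfl⟩
    exact sub_mem (Ideal.subset_span ⟨_, .inl ⟨i, rfl⟩, rfl⟩)
      (Ideal.subset_span ⟨_, .inr ⟨i, rfl⟩, rfl⟩)
  obtain ⟨d, ⟨i, rfl⟩ | ⟨i, rfl⟩, hd⟩ := mem_ideal_span_monomial_image.1 (hle hf) m hm
  exacts [⟨i, .inl hd⟩, ⟨i, .inr hd⟩]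

/-- Nonnegative functionals on the degrees separate monomials by the faces that contain them. -/
theorem Grading.card_le_ara_ofVectors {σ : Type} {K : Type v} [Field K] {M : Type u}
    [AddCommGroup M] {b : σ → M} {ι κ : Type*} [Fintype ι] {J : Ideal (MvPolynomial σ K)}
    {s : ι → Finset σ} (hs : ∀ i, Minimal (· ∈ monomialSupports J.radical) (s i))
    {ℓ : κ → M →+ ℤ} (hℓ : ∀ k e, 0 ≤ ℓ k (b e))
    (hsep : ∀ i j, (∀ k, (∀ e ∈ s i, ℓ k (b e) = 0) ↔ ∀ e ∈ s j, ℓ k (b e) = 0) → i = j) :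
    Fintype.card ι ≤ (ofVectors b).ara J := by
  refine card_le_ara hs fun i j m n hm hn h => hsep i j fun k => ?_
  rw [weightCon_ofVectors] at h
  rw [← hm, ← hn]
  exact forall_mem_support_eq_zero_iff_of_weightCon (hℓ k) h

end MonomialSupports

section Generation

variable {σ M : Type*} [AddCommMonoid M]

/-- Up to the congruence `c`, the exponent `m` involves the variable `i`. -/
def Involves (c : AddCon (σ →₀ ℕ)) (m : σ →₀ ℕ) (i : σ) : Prop :=
  ∃ m', c m (single i 1 + m')

theorem Involves.of_le {c : AddCon (σ →₀ ℕ)} {s t m : σ →₀ ℕ} {i : σ} (hst : c s t) (hs : s ≤ m)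
    (ht : 0 < t i) : Involves c m i := by
  refine ⟨t - single i 1 + (m - s), ?_⟩
  rw [← add_assoc, add_tsub_cancel_of_le (Finsupp.single_le_iff.2 ht)]
  nth_rw 1 [← add_tsub_cancel_of_le hs]
  exact c.add hst (c.refl _)

theorem Involves.of_pos {c : AddCon (σ →₀ ℕ)} {m : σ →₀ ℕ} {i : σ} (hi : 0 < m i) :
    Involves c m i :=
  .of_le (c.refl m) le_rfl hi

/-- Cancel the common variables one after the other. -/
theorem weightCon_le_of_exists_involves [IsCancelAdd M] {w : σ → M} {ℓ : M →+ ℤ}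
    (hℓ : ∀ i, 0 < ℓ (w i)) {c : AddCon (σ →₀ ℕ)} (hc : c ≤ weightCon w)
    (hcommon : ∀ m n, weightCon w m n → m ≠ 0 → ∃ i, Involves c m i ∧ Involves c n i) :
    weightCon w ≤ c := by
  have hnonneg (m : σ →₀ ℕ) : 0 ≤ ℓ (weight w m) := by
    rw [map_weight, Finsupp.weight_apply]
    exact Finset.sum_nonneg fun i _ => nsmul_nonneg (hℓ i).le _
  have hzero {m : σ →₀ ℕ} (hm : weightCon w m 0) : m = 0 := by
    have hm' : ∀ i ∈ m.support, ℓ (w i) = 0 :=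
      (forall_mem_support_eq_zero_iff_of_weightCon (fun i => (hℓ i).le) hm).2 (by simp)
    exact Finsupp.support_eq_empty.1 <|
      Finset.eq_empty_of_forall_notMem fun i hi => (hℓ i).ne' (hm' i hi)
  have hweight {m m' : σ →₀ ℕ} {i : σ} (h : c m (single i 1 + m')) :
      weight w m = w i + weight w m' := by
    rw [show weight w m = _ from hc h, map_add, Finsupp.weight_single, one_smul]
  intro m n h
  induction hd : (ℓ (weight w m)).toNat using Nat.strong_induction_on generalizing m n with
  | _ d ih =>
  rcases eq_or_ne m 0 with rfl | hm0
  · rw [hzero h.symm]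
    exact c.refl 0
  obtain ⟨i, ⟨m', hm⟩, n', hn⟩ := hcommon m n h hm0
  have hmn' : weightCon w m' n' := by
    refine add_left_cancel (a := w i) ?_
    rw [← hweight hm, ← hweight hn]
    exact h
  have hlt : (ℓ (weight w m')).toNat < d := by
    have := hnonneg m'
    have := hℓ i
    rw [← hd, hweight hm, map_add]
    omega
  exact c.trans hm (c.trans (c.add (c.refl _) (ih _ hlt hmn' rfl)) (c.symm hn))

end Generation

section SquarefreeExponent

variable {σ M : Type*} [AddCommMonoid M]

/-- The exponent of the squarefree monomial with support `s`. -/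
noncomputable def squarefreeExponent (s : Finset σ) : σ →₀ ℕ :=
  ∑ e ∈ s, single e 1

theorem squarefreeExponent_apply [DecidableEq σ] (s : Finset σ) (e : σ) :
    squarefreeExponent s e = if e ∈ s then 1 else 0 := by
  simp [squarefreeExponent, Finsupp.single_apply]

theorem support_squarefreeExponent (s : Finset σ) : (squarefreeExponent s).support = s := by
  classical
  ext e
  simp [squarefreeExponent_apply]

theorem squarefreeExponent_le_iff {s : Finset σ} {m : σ →₀ ℕ} :
    squarefreeExponent s ≤ m ↔ s ⊆ m.support := by
  classical
  simp only [Finsupp.le_def, squarefreeExponent_apply, Finset.subset_iff, Finsupp.mem_support_iff]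
  exact forall_congr' fun e => by split_ifs <;> simp [*, Nat.one_le_iff_ne_zero]

theorem weight_squarefreeExponent (w : σ → M) (s : Finset σ) :
    weight w (squarefreeExponent s) = ∑ e ∈ s, w e := by
  simp [squarefreeExponent, Finsupp.weight_single]

theorem weightCon_squarefreeExponent_iff {w : σ → M} {s t : Finset σ} :
    weightCon w (squarefreeExponent s) (squarefreeExponent t) ↔ ∑ e ∈ s, w e = ∑ e ∈ t, w e := by
  rw [← weight_squarefreeExponent, ← weight_squarefreeExponent]
  rfl

theorem squarefreeExponent_pair [DecidableEq σ] {e e' : σ} (h : e ≠ e') :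
    squarefreeExponent {e, e'} = single e 1 + single e' 1 :=
  Finset.sum_pair h

theorem involves_of_squarefreeExponent {c : AddCon (σ →₀ ℕ)} {s t : Finset σ}
    (hst : c (squarefreeExponent s) (squarefreeExponent t)) {m : σ →₀ ℕ}
    (hs : ∀ e ∈ s, 0 < m e) {e : σ} (he : e ∈ t) : Involves c m e := by
  classical
  exact .of_le hst
    (squarefreeExponent_le_iff.2 fun e he => Finsupp.mem_support_iff.2 (hs e he).ne')
    (by simp [squarefreeExponent_apply, he])

theorem monomial_squarefreeExponent_mul_mem {R : Type*} [CommRing R]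
    {J : Ideal (MvPolynomial σ R)} {e : σ} {p q : σ →₀ ℕ}
    (h : binomialCon J (single e 1 + p) (single e 1 + q)) {s : Finset σ} (he : e ∈ s) :
    monomial (squarefreeExponent s) 1 * (monomial p 1 - monomial q 1) ∈ J := by
  classical
  have h' := (binomialCon J).add ((binomialCon J).refl (squarefreeExponent (s.erase e))) h
  have hs : squarefreeExponent (s.erase e) + single e 1 = squarefreeExponent s :=
    Finset.sum_erase_add _ _ he
  rw [← add_assoc, ← add_assoc, hs] at h'
  rw [mul_sub, monomial_mul, monomial_mul, mul_one]
  exact h'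

end SquarefreeExponent

section Height

variable {σ M K : Type*} [CommRing K] [IsDomain K] [AddCommMonoid M]

/-- Recording the exponents of the variables `e i` one after the other cuts out a chain of toric
ideals. -/
theorem le_height_toricIdeal [UniqueSums M] {k : ℕ} (w : σ → M) (e : Fin k → σ)
    (m n : Fin k → σ →₀ ℕ) (hmn : ∀ i, weightCon w (m i) (n i))
    (hne : ∀ i, m i (e i) ≠ n i (e i)) (heq : ∀ i j, i < j → m j (e i) = n j (e i)) :
    k ≤ (toricIdeal K w).height := by
  classical
  induction k generalizing M with
  | zero => exact bot_le
  | succ k ih =>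
    let w' (i : σ) : M × ℕ := (w i, Pi.single (M := fun _ => ℕ) (e 0) 1 i)
    have hw' {m n : σ →₀ ℕ} : weightCon w' m n ↔ weightCon w m n ∧ m (e 0) = n (e 0) := by
      rw [weightCon_prodMk_iff]
      change _ ∧ weight (Pi.single (e 0) 1) m = weight (Pi.single (e 0) 1) n ↔ _
      rw [Finsupp.weight_single_one_apply, Finsupp.weight_single_one_apply]
    have hlt : toricIdeal K w' < toricIdeal K w := by
      rw [lt_iff_le_not_ge, toricIdeal_le_toricIdeal_iff, toricIdeal_le_toricIdeal_iff]
      exact ⟨fun _ _ h => (hw'.1 h).1, fun h => hne 0 (hw'.1 (h (hmn 0))).2⟩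
    calc ((k + 1 : ℕ) : ℕ∞) = k + 1 := by push_cast; rfl
      _ ≤ (toricIdeal K w').height + 1 := by
        gcongr
        exact ih w' (fun i => e i.succ) (fun i => m i.succ) (fun i => n i.succ)
          (fun i => hw'.2 ⟨hmn i.succ, heq 0 i.succ i.succ_pos⟩) (fun i => hne i.succ)
          fun i j hij => heq _ _ (Fin.succ_lt_succ_iff.2 hij)
      _ ≤ (toricIdeal K w).height := Ideal.height_add_one_le_of_lt_of_isPrime hlt

/-- The lattice of the differences of congruent exponents. -/
def differenceLattice (c : AddCon (σ →₀ ℕ)) : AddSubgroup (σ → ℤ) where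
  carrier := {α | ∃ m n, c m n ∧ α = fun i => (m i : ℤ) - n i}
  zero_mem' := ⟨0, 0, c.refl 0, by ext; simp⟩
  add_mem' := by
    rintro _ _ ⟨m, n, h, rfl⟩ ⟨m', n', h', rfl⟩
    refine ⟨m + m', n + n', c.add h h', ?_⟩
    ext i
    simp only [Pi.add_apply, Finsupp.add_apply]
    omega
  neg_mem' := by
    rintro _ ⟨m, n, h, rfl⟩
    exact ⟨n, m, c.symm h, by ext; simp⟩

theorem of_sub_mem_differenceLattice {c : AddCon (σ →₀ ℕ)}
    (hcancel : ∀ {m n d}, c (m + d) (n + d) → c m n) {m n : σ →₀ ℕ}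
    (h : (fun i => (m i : ℤ) - n i) ∈ differenceLattice c) : c m n := by
  obtain ⟨m', n', hc, hdiff⟩ := h
  have hadd : m + n' = n + m' := by
    ext i
    have := congrFun hdiff i
    simp only [Finsupp.add_apply]
    omega
  exact hcancel (d := n') (hadd ▸ c.add (c.refl n) hc)

/-- A prime ideal below a toric ideal contains no monomial, so the binomials in it are determined by
their lattice. -/
theorem binomialCon_of_add_right {w : σ → M} {Q : Ideal (MvPolynomial σ K)} [Q.IsPrime]
    (hQ : Q ≤ toricIdeal K w) {m n d : σ →₀ ℕ} (h : binomialCon Q (m + d) (n + d)) :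
    binomialCon Q m n := by
  have hd : monomial d (1 : K) ∉ Q := fun hd => by
    have : monomialHom K w (monomial d 1) = 0 := hQ hd
    rw [monomialHom_monomial, AddMonoidAlgebra.single_eq_zero] at this
    exact one_ne_zero this
  have hmul : (monomial m (1 : K) - monomial n 1) * monomial d 1 ∈ Q := by
    rw [sub_mul, monomial_mul, monomial_mul, mul_one]
    exact h
  exact (Ideal.IsPrime.mem_or_mem ‹_› hmul).resolve_right hd

theorem toricIdeal_mem_minimalPrimes_span [UniqueSums M] {ι : Type*} {w : σ → M}
    {p q : ι → σ →₀ ℕ} (hpq : ∀ j, weightCon w (p j) (q j))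
    (hspan : ∀ m n, weightCon w m n → (fun i => (m i : ℤ) - n i) ∈
      AddSubgroup.closure (Set.range fun j i => (p j i : ℤ) - q j i)) :
    toricIdeal K w ∈ Ideal.minimalPrimes
      (Ideal.span (Set.range fun j => monomial (p j) 1 - monomial (q j) 1)) := by
  refine ⟨⟨inferInstance, Ideal.span_le.2 ?_⟩, fun Q ⟨hprime, hpqQ⟩ hQ => ?_⟩
  · rintro _ ⟨j, rfl⟩
    exact toricIdeal_le_iff.1 le_rfl (hpq j)
  · have hle : AddSubgroup.closure (Set.range fun j i => (p j i : ℤ) - q j i) ≤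
        differenceLattice (binomialCon Q) := by
      rw [AddSubgroup.closure_le]
      rintro _ ⟨j, rfl⟩
      exact ⟨p j, q j, hpqQ (Ideal.subset_span ⟨j, rfl⟩), rfl⟩
    exact toricIdeal_le_iff.2 fun m n h =>
      of_sub_mem_differenceLattice (binomialCon_of_add_right hQ) (hle (hspan m n h))

theorem height_toricIdeal_le_card [IsNoetherianRing K] [Finite σ] [UniqueSums M] {ι : Type*}
    [Fintype ι] {w : σ → M} {p q : ι → σ →₀ ℕ} (hpq : ∀ j, weightCon w (p j) (q j))
    (hspan : ∀ m n, weightCon w m n → (fun i => (m i : ℤ) - n i) ∈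
      AddSubgroup.closure (Set.range fun j i => (p j i : ℤ) - q j i)) :
    (toricIdeal K w).height ≤ Fintype.card ι := by
  refine (Ideal.height_le_card_of_mem_minimalPrimes_span (Set.finite_range _)
    (toricIdeal_mem_minimalPrimes_span hpq hspan)).trans ?_
  rw [← Set.image_univ, ← Nat.card_eq_fintype_card, ← Set.ncard_univ]
  exact_mod_cast Set.ncard_image_le Set.finite_univ

end Height

theorem mem_radical_of_sum_mem_of_mul_mem {R ι : Type*} [CommRing R] [Fintype ι] {J : Ideal R}
    {a : ι → R} (hsum : ∑ i, a i ∈ J) (hmul : ∀ i j, i ≠ j → a i * a j ∈ J) (i : ι) :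
    a i ∈ J.radical := by
  classical
  refine ⟨2, ?_⟩
  have hsplit : a i ^ 2 = a i * ∑ j, a j - ∑ j ∈ Finset.univ.erase i, a i * a j := by
    rw [← Finset.add_sum_erase _ _ (Finset.mem_univ i), mul_add, Finset.mul_sum]
    ring
  rw [hsplit]
  exact J.sub_mem (J.mul_mem_left _ hsum)
    (J.sum_mem fun j hj => hmul i j (Finset.ne_of_mem_erase hj).symm)

namespace CubeEdge

/-- The edge at the vertex `v` in the direction `d`; the directions `0, 1, 2` are those of the edges
`12`, `14`, `15`. -/
def edgeAt : Fin 8 → Fin 3 → CubeEdge :=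
  ![![e12, e14, e15], ![e12, e23, e26], ![e34, e23, e37], ![e34, e14, e48],
    ![e56, e58, e15], ![e56, e67, e26], ![e78, e67, e37], ![e78, e58, e48]]

/-- The other end of `edgeAt v d`. -/
def neighbor : Fin 8 → Fin 3 → Fin 8 :=
  ![![1, 3, 4], ![0, 2, 5], ![3, 1, 6], ![2, 0, 7], ![5, 7, 0], ![4, 6, 1], ![7, 5, 2], ![6, 4, 3]]

@[simp]
theorem neighbor_neighbor (v : Fin 8) (d : Fin 3) : neighbor (neighbor v d) d = v := by
  revert v d
  decide

@[simp]
theorem edgeAt_neighbor (v : Fin 8) (d : Fin 3) : edgeAt (neighbor v d) d = edgeAt v d := by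
  revert v d
  decide

theorem neighbor_comm (v : Fin 8) (d d' : Fin 3) :
    neighbor (neighbor v d) d' = neighbor (neighbor v d') d := by
  revert v d d'
  decide

theorem exists_edgeAt_eq (e : CubeEdge) : ∃ v d, edgeAt v d = e := by
  revert e
  decide

theorem aVec_nonneg (e : CubeEdge) (v : Fin 8) : 0 ≤ aVec e v := by
  revert e v
  decide

theorem weight_aVec_apply (m : CubeEdge →₀ ℕ) (v : Fin 8) :
    weight aVec m v = (∑ d, m (edgeAt v d) : ℕ) := by
  have haVec : ∀ e v, aVec e v = ∑ d, if edgeAt v d = e then 1 else 0 := by decide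
  rw [show weight aVec m v = weight (fun e => aVec e v) m from
    map_weight (Pi.evalAddMonoidHom _ v) aVec m, Finsupp.weight_eq_sum]
  simp only [haVec, nsmul_eq_mul, Finset.mul_sum]
  rw [Finset.sum_comm]
  simp

theorem sum_edgeAt_eq {m n : CubeEdge →₀ ℕ} (h : weightCon aVec m n) (v : Fin 8) :
    ∑ d, m (edgeAt v d) = ∑ d, n (edgeAt v d) := by
  have hv : weight aVec m v = weight aVec n v := congrFun h v
  simpa only [weight_aVec_apply, Nat.cast_inj] using hv

/-- The chordless cycles of the cube, the six squares and the four hexagons, each split into two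
perfect matchings: this is the first one. -/
def cyclePos : Fin 6 ⊕ Fin 4 → Finset CubeEdge :=
  Sum.elim
    ![{e12, e34}, {e12, e56}, {e23, e67}, {e34, e78}, {e14, e58}, {e56, e78}]
    ![{e23, e48, e56}, {e14, e37, e56}, {e12, e48, e67}, {e12, e37, e58}]

/-- The second perfect matching of each chordless cycle of the cube. -/
def cycleNeg : Fin 6 ⊕ Fin 4 → Finset CubeEdge :=
  Sum.elim
    ![{e14, e23}, {e15, e26}, {e26, e37}, {e37, e48}, {e15, e48}, {e58, e67}]
    ![{e26, e34, e58}, {e15, e34, e67}, {e14, e26, e78}, {e15, e23, e78}]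

theorem weightCon_aVec_cycle (i : Fin 6 ⊕ Fin 4) :
    weightCon aVec (squarefreeExponent (cyclePos i)) (squarefreeExponent (cycleNeg i)) := by
  rw [weightCon_squarefreeExponent_iff]
  revert i
  decide

section Moves

variable {c : AddCon (CubeEdge →₀ ℕ)}

theorem square_move
    (hc : ∀ k : Fin 6, c (squarefreeExponent (cyclePos (.inl k)))
      (squarefreeExponent (cycleNeg (.inl k))))
    (v : Fin 8) {i j : Fin 3} (hij : i ≠ j) :
    c (squarefreeExponent {edgeAt v i, edgeAt (neighbor v j) i})
      (squarefreeExponent {edgeAt v j, edgeAt (neighbor v i) j}) := by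
  have hmatch : ∀ v i j, i ≠ j → ∃ k : Fin 6,
      (cyclePos (.inl k) = {edgeAt v i, edgeAt (neighbor v j) i} ∧
        cycleNeg (.inl k) = {edgeAt v j, edgeAt (neighbor v i) j}) ∨
      (cyclePos (.inl k) = {edgeAt v j, edgeAt (neighbor v i) j} ∧
        cycleNeg (.inl k) = {edgeAt v i, edgeAt (neighbor v j) i}) := by
    decide +kernel
  obtain ⟨k, ⟨hpos, hneg⟩ | ⟨hpos, hneg⟩⟩ := hmatch v i j hij
  · exact hpos ▸ hneg ▸ hc k
  · exact hpos ▸ hneg ▸ c.symm (hc k)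

/-- One of the two perfect matchings of the hexagon that avoids `v` and the opposite vertex; the
other one is `hexagonAround v j i l`. -/
def hexagonAround (v : Fin 8) (i j l : Fin 3) : Finset CubeEdge :=
  {edgeAt (neighbor v i) j, edgeAt (neighbor v j) l, edgeAt (neighbor v l) i}

theorem hexagon_move
    (hc : ∀ k : Fin 4, c (squarefreeExponent (cyclePos (.inr k)))
      (squarefreeExponent (cycleNeg (.inr k))))
    (v : Fin 8) {i j l : Fin 3} (hij : i ≠ j) (hli : l ≠ i) (hlj : l ≠ j) :
    c (squarefreeExponent (hexagonAround v i j l))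
      (squarefreeExponent (hexagonAround v j i l)) := by
  have hmatch : ∀ v i j l, i ≠ j → l ≠ i → l ≠ j → ∃ k : Fin 4,
      (cyclePos (.inr k) = hexagonAround v i j l ∧ cycleNeg (.inr k) = hexagonAround v j i l) ∨
      (cyclePos (.inr k) = hexagonAround v j i l ∧ cycleNeg (.inr k) = hexagonAround v i j l) := by
    decide +kernel
  obtain ⟨k, ⟨hpos, hneg⟩ | ⟨hpos, hneg⟩⟩ := hmatch v i j l hij hli hlj
  · exact hpos ▸ hneg ▸ hc k
  · exact hpos ▸ hneg ▸ c.symm (hc k)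

end Moves

theorem exists_edgeAt_pos {m n : CubeEdge →₀ ℕ} (h : weightCon aVec m n) {v : Fin 8} {d : Fin 3}
    (hm : 0 < m (edgeAt v d)) : ∃ d', 0 < n (edgeAt v d') := by
  by_contra! hn
  have hsum := sum_edgeAt_eq h v
  rw [Finset.sum_eq_zero fun d' _ => Nat.le_zero.1 (hn d'), Finset.sum_eq_zero_iff] at hsum
  exact hm.ne' (hsum d (Finset.mem_univ d))

section Generation

variable {c : AddCon (CubeEdge →₀ ℕ)}

theorem involves_of_square
    (hc : ∀ k, c (squarefreeExponent (cyclePos k)) (squarefreeExponent (cycleNeg k)))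
    {m : CubeEdge →₀ ℕ} {v : Fin 8} {i j : Fin 3} (hij : i ≠ j) (h : 0 < m (edgeAt v i))
    (h' : 0 < m (edgeAt (neighbor v j) i)) :
    Involves c m (edgeAt v j) ∧ Involves c m (edgeAt (neighbor v i) j) := by
  have hmove {e : CubeEdge} :=
    involves_of_squarefreeExponent (m := m) (e := e) (square_move (fun k => hc (.inl k)) v hij)
      (by simp [h, h'])
  exact ⟨hmove (by simp), hmove (by simp)⟩

/-- Unless a square move yields a common edge, `m` contains a perfect matching of the hexagon
through `v` that avoids the neighbor of `v` in the third direction. -/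
theorem exists_involves_of_ne
    (hc : ∀ k, c (squarefreeExponent (cyclePos k)) (squarefreeExponent (cycleNeg k)))
    {m n : CubeEdge →₀ ℕ} (h : weightCon aVec m n) {v : Fin 8} {i j : Fin 3} (hij : i ≠ j)
    (hm : 0 < m (edgeAt v i)) (hn : 0 < n (edgeAt v j)) :
    ∃ e, Involves c m e ∧ Involves c n e := by
  have hthird : ∀ i j : Fin 3, i ≠ j → ∃ l, l ≠ i ∧ l ≠ j ∧ ∀ d, d = i ∨ d = j ∨ d = l := by
    decide
  obtain ⟨l, hli, hlj, hdir⟩ := hthird i j hij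
  have h_symm := (weightCon aVec).symm h
  by_contra hnone
  have hn_i : 0 < n (edgeAt (neighbor v i) l) := by
    obtain ⟨d, hd⟩ := exists_edgeAt_pos h (v := neighbor v i) (d := i) (by simpa using hm)
    obtain rfl | rfl | rfl := hdir d
    · exact absurd ⟨_, .of_pos hm, .of_pos (by simpa using hd)⟩ hnone
    · exact absurd ⟨_, .of_pos hm, (involves_of_square hc hij.symm hn hd).1⟩ hnone
    · exact hd
  have hm_j : 0 < m (edgeAt (neighbor v j) l) := by
    obtain ⟨d, hd⟩ := exists_edgeAt_pos h_symm (v := neighbor v j) (d := j) (by simpa using hn)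
    obtain rfl | rfl | rfl := hdir d
    · exact absurd ⟨_, (involves_of_square hc hij hm hd).1, .of_pos hn⟩ hnone
    · exact absurd ⟨_, .of_pos (by simpa using hd), .of_pos hn⟩ hnone
    · exact hd
  obtain ⟨d, hd⟩ := exists_edgeAt_pos h_symm (v := neighbor (neighbor v i) l) (d := l)
    (by simpa using hn_i)
  obtain rfl | rfl | rfl := hdir d
  · rw [neighbor_comm, edgeAt_neighbor] at hd
    exact hnone ⟨_, (involves_of_square hc hli.symm hm hd).2, .of_pos hn_i⟩
  · have hmatching : ∀ e ∈ hexagonAround (neighbor v l) i d l, 0 < m e := by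
      rw [neighbor_comm] at hd
      rw [← edgeAt_neighbor, neighbor_comm] at hm_j
      simp [hexagonAround, hm, hd, hm_j]
    exact hnone ⟨edgeAt v d, involves_of_squarefreeExponent
      (hexagon_move (fun k => hc (.inr k)) (neighbor v l) hij hli hlj) hmatching
      (by simp [hexagonAround]), .of_pos hn⟩
  · exact hnone ⟨_, .of_pos (by simpa using hd), .of_pos hn_i⟩

theorem exists_involves
    (hc : ∀ k, c (squarefreeExponent (cyclePos k)) (squarefreeExponent (cycleNeg k)))
    {m n : CubeEdge →₀ ℕ} (h : weightCon aVec m n) (hm : m ≠ 0) :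
    ∃ e, Involves c m e ∧ Involves c n e := by
  obtain ⟨e, he⟩ := Finsupp.support_nonempty_iff.2 hm
  have he : 0 < m e := Nat.pos_of_ne_zero (Finsupp.mem_support_iff.1 he)
  obtain ⟨v, i, rfl⟩ := exists_edgeAt_eq e
  obtain ⟨j, hj⟩ := exists_edgeAt_pos h he
  obtain rfl | hij := eq_or_ne i j
  · exact ⟨_, .of_pos he, .of_pos hj⟩
  · exact exists_involves_of_ne hc h hij he hj

end Generation

variable (K : Type v) [Field K]

/-- The binomial of a chordless cycle, the difference of the products over its two perfect
matchings. -/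
noncomputable def cycleBinomial (i : Fin 6 ⊕ Fin 4) : MvPolynomial CubeEdge K :=
  monomial (squarefreeExponent (cyclePos i)) 1 - monomial (squarefreeExponent (cycleNeg i)) 1

theorem cubeIdeal_eq_toricIdeal : cubeIdeal K = toricIdeal K aVec := by
  rw [cubeIdeal, Grading.latticeIdeal_relLattice]
  exact toricIdeal_eq_toricIdeal_iff.2 (Grading.weightCon_ofVectors aVec)

theorem cycleBinomial_mem_cubeIdeal (i : Fin 6 ⊕ Fin 4) : cycleBinomial K i ∈ cubeIdeal K := by
  have h := weightCon_aVec_cycle i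
  rwa [← binomialCon_toricIdeal (K := K), ← cubeIdeal_eq_toricIdeal] at h

theorem cubeIdeal_eq_span_cycleBinomial :
    cubeIdeal K = Ideal.span (Set.range (cycleBinomial K)) := by
  have hge : Ideal.span (Set.range (cycleBinomial K)) ≤ cubeIdeal K :=
    Ideal.span_le.2 (Set.range_subset_iff.2 (cycleBinomial_mem_cubeIdeal K))
  refine le_antisymm ?_ hge
  rw [cubeIdeal_eq_toricIdeal] at hge ⊢
  have hle : binomialCon (Ideal.span (Set.range (cycleBinomial K))) ≤ weightCon aVec := by
    rw [← binomialCon_toricIdeal (K := K)]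
    exact fun m n h => hge h
  have hcycle (k : Fin 6 ⊕ Fin 4) : binomialCon (Ideal.span (Set.range (cycleBinomial K)))
      (squarefreeExponent (cyclePos k)) (squarefreeExponent (cycleNeg k)) :=
    Ideal.subset_span (Set.mem_range_self k)
  exact toricIdeal_le_iff.2 <|
    weightCon_le_of_exists_involves (ℓ := ∑ v, Pi.evalAddMonoidHom (fun _ : Fin 8 => ℤ) v)
      (by decide) hle fun m n h hm => exists_involves hcycle h hm

instance cubeIdeal_isPrime : (cubeIdeal K).IsPrime := by
  rw [cubeIdeal_eq_toricIdeal]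
  infer_instance

theorem cubeIdeal_eq_ker_cubeHom : cubeIdeal K = RingHom.ker (cubeHom K) := by
  let w (e : CubeEdge) : Fin 8 →₀ ℕ := single e.ends.1 1 + single e.ends.2 1
  let toInt : (Fin 8 →₀ ℕ) →+ (Fin 8 → ℤ) :=
    ((Nat.castAddMonoidHom ℤ).compLeft (Fin 8)).comp Finsupp.coeFnAddHom
  have htoInt : Function.Injective toInt := fun m n h =>
    Finsupp.ext fun v => Nat.cast_injective (congrFun h v)
  have haVec : (fun e => toInt (w e)) = aVec := by
    ext e v
    simp [toInt, w, aVec, Finsupp.single_apply, Pi.single_apply, eq_comm]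
  have hhom : monomialHom K w = cubeHom K := MvPolynomial.algHom_ext fun e => by
    rw [monomialHom_X, cubeHom, aeval_X, X, X, monomial_mul, mul_one]
    rfl
  rw [cubeIdeal_eq_toricIdeal, ← hhom, ← haVec]
  exact toricIdeal_eq_toricIdeal_iff.2 (weightCon_map_of_injective htoInt w)

/-- The degree map of `bVec` on the vertices: the vector of an edge is the sum of the rows of its
ends. -/
def vertexWeight : Matrix (Fin 8) (Fin 4) ℤ :=
  !![0, 0, 0, 0; 5, 0, 3, 4; -1, 0, -1, -1; 3, 1, 5, 5; 4, 1, 4, 8; 0, 0, -2, 2; 3, 1, 3, 7;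
    -2, 1, 0, 3]

theorem aVec_vecMul_vertexWeight (e : CubeEdge) : Matrix.vecMul (aVec e) vertexWeight = bVec e := by
  revert e
  decide

theorem weightCon_aVec_le_weightCon_bVec : weightCon aVec ≤ weightCon bVec := by
  have h := weightCon_le_weightCon_map (Matrix.vecMulLinear vertexWeight).toAddMonoidHom aVec
  exact h.trans_eq (congrArg weightCon (funext aVec_vecMul_vertexWeight))

variable {K} in
theorem isSpecialization_cubeF_cubeG : Grading.IsSpecialization K cubeF cubeG := by
  simpa only [Grading.isSpecialization_iff, cubeF, cubeG, Grading.weightCon_ofVectors] using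
    weightCon_aVec_le_weightCon_bVec

section LowerBounds

theorem minimal_cyclePos_monomialSupports (i : Fin 6 ⊕ Fin 4) :
    Minimal (· ∈ monomialSupports (cubeIdeal K).radical) (cyclePos i) := by
  have hpos : ∀ i j, cyclePos j ⊆ cyclePos i → i = j := by decide
  have hneg : ∀ i j, ¬ cycleNeg j ⊆ cyclePos i := by decide
  rw [(cubeIdeal_isPrime K).radical]
  constructor
  · refine ⟨_, cycleBinomial_mem_cubeIdeal K i, squarefreeExponent (cyclePos i), ?_,
      support_squarefreeExponent _⟩
    have hne : squarefreeExponent (cycleNeg i) ≠ squarefreeExponent (cyclePos i) := fun h =>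
      hneg i i (by simpa only [support_squarefreeExponent] using (congrArg Finsupp.support h).le)
    rw [mem_support_iff, cycleBinomial, coeff_sub, coeff_monomial, coeff_monomial, if_pos rfl,
      if_neg hne, sub_zero]
    exact one_ne_zero
  · rintro _ ⟨f, hf, m, hm, rfl⟩ hle
    rw [cubeIdeal_eq_span_cycleBinomial] at hf
    obtain ⟨j, h | h⟩ := exists_le_of_mem_span_monomial_sub_monomial hf hm
    · rw [squarefreeExponent_le_iff] at h
      rwa [hpos i j (h.trans hle)]
    · exact absurd ((squarefreeExponent_le_iff.1 h).trans hle) (hneg i j)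

theorem ten_le_ara_cubeG : 10 ≤ cubeG.ara (cubeIdeal K) := by
  refine Grading.card_le_ara_ofVectors (minimal_cyclePos_monomialSupports K)
    (ℓ := Pi.evalAddMonoidHom fun _ : Fin 8 => ℤ) (fun v e => aVec_nonneg e v) ?_
  decide +kernel

/-- The cone spanned by the vectors `bVec` is a cone over a cube. These are the functionals of its
facets, which are spanned by the squares of the cube graph. -/
def facet (l : Fin 6) : (Fin 4 → ℤ) →+ ℤ :=
  AddMonoidHom.mk'
    (dotProduct (![![-1, -2, -1, 2], ![7, 32, -5, -5], ![-3, -12, 3, 2], ![-1, -6, 1, 1],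
      ![17, 64, -13, -10], ![3, 10, -1, -2]] l))
    (dotProduct_add _)

theorem seven_le_ara_cubeF : 7 ≤ cubeF.ara (cubeIdeal K) := by
  have hfacet : ∀ l e, 0 ≤ facet l (bVec e) := by decide +kernel
  refine Grading.card_le_ara_ofVectors (ι := Option (Fin 6))
    (fun i => minimal_cyclePos_monomialSupports K (i.elim (.inr 0) .inl)) hfacet ?_
  decide +kernel

end LowerBounds

section UpperBounds

variable {K}

theorem squarefreeExponent_hexagonAround (v : Fin 8) {i j l : Fin 3} (hij : i ≠ j) (hli : l ≠ i)
    (hlj : l ≠ j) : squarefreeExponent (hexagonAround v i j l) =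
      single (edgeAt (neighbor v i) j) 1 + single (edgeAt (neighbor v j) l) 1 +
        single (edgeAt (neighbor v l) i) 1 := by
  have hne : ∀ v i j l, i ≠ j → l ≠ i → l ≠ j →
      edgeAt (neighbor v i) j ∉
          ({edgeAt (neighbor v j) l, edgeAt (neighbor v l) i} : Finset CubeEdge) ∧
        edgeAt (neighbor v j) l ≠ edgeAt (neighbor v l) i := by
    decide +kernel
  obtain ⟨h, h'⟩ := hne v i j l hij hli hlj
  rw [squarefreeExponent, hexagonAround, Finset.sum_insert h, Finset.sum_pair h', add_assoc]

theorem single_add_hexagon_move {c : AddCon (CubeEdge →₀ ℕ)}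
    (hc : ∀ k : Fin 6, c (squarefreeExponent (cyclePos (.inl k)))
      (squarefreeExponent (cycleNeg (.inl k))))
    (v : Fin 8) {i j l : Fin 3} (hij : i ≠ j) (hli : l ≠ i) (hlj : l ≠ j) :
    c (single (edgeAt v i) 1 + squarefreeExponent (hexagonAround v i j l))
      (single (edgeAt v i) 1 + squarefreeExponent (hexagonAround v j i l)) := by
  have hne : ∀ v i j, i ≠ j → edgeAt v i ≠ edgeAt (neighbor v j) i := by decide +kernel
  have square {i j : Fin 3} (hij : i ≠ j) :
      c (single (edgeAt v i) 1 + single (edgeAt (neighbor v j) i) 1)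
        (single (edgeAt v j) 1 + single (edgeAt (neighbor v i) j) 1) := by
    have h := square_move hc v hij
    rwa [squarefreeExponent_pair (hne v i j hij), squarefreeExponent_pair (hne v j i hij.symm)] at h
  rw [squarefreeExponent_hexagonAround v hij hli hlj,
    squarefreeExponent_hexagonAround v hij.symm hlj hli]
  have h₁ := c.add (square hli.symm) (c.refl
    (single (edgeAt (neighbor v i) j) 1 + single (edgeAt (neighbor v j) l) 1))
  have h₂ := c.add (square hlj) (c.refl
    (single (edgeAt (neighbor v i) j) 1 + single (edgeAt (neighbor v i) l) 1))
  have h₃ := c.add (square hij.symm) (c.refl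
    (single (edgeAt (neighbor v i) l) 1 + single (edgeAt (neighbor v l) j) 1))
  convert c.trans h₁ (c.trans ?_ (c.trans h₂ (c.trans ?_ h₃))) using 1
  · abel
  · abel
  · convert c.refl _ using 1
    abel
  · convert c.refl _ using 1
    abel

theorem hexagon_mul_hexagon_mem {J : Ideal (MvPolynomial CubeEdge K)}
    (hJ : ∀ k, cycleBinomial K (.inl k) ∈ J) {a b : Fin 4} (hab : a ≠ b) :
    cycleBinomial K (.inr a) * cycleBinomial K (.inr b) ∈ J := by
  have hedge : ∀ a b : Fin 4, a ≠ b → ∀ s, s = cyclePos (.inr b) ∨ s = cycleNeg (.inr b) →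
      ∃ v i j l, i ≠ j ∧ l ≠ i ∧ l ≠ j ∧ cyclePos (.inr a) = hexagonAround v i j l ∧
        cycleNeg (.inr a) = hexagonAround v j i l ∧ edgeAt v i ∈ s := by
    simp only [forall_eq_or_imp, forall_eq]
    decide +kernel
  have hmem (s) (hs : s = cyclePos (.inr b) ∨ s = cycleNeg (.inr b)) :
      monomial (squarefreeExponent s) 1 * cycleBinomial K (.inr a) ∈ J := by
    obtain ⟨v, i, j, l, hij, hli, hlj, hpos, hneg, he⟩ := hedge a b hab s hs
    rw [cycleBinomial, hpos, hneg]
    exact monomial_squarefreeExponent_mul_mem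
      (single_add_hexagon_move (c := binomialCon J) hJ v hij hli hlj) he
  rw [mul_comm, cycleBinomial, sub_mul]
  exact J.sub_mem (hmem _ (.inl rfl)) (hmem _ (.inr rfl))

theorem isHomogeneous_cycleBinomial (i : Fin 6 ⊕ Fin 4) :
    cubeG.IsHomogeneous (cycleBinomial K i) := by
  refine Grading.isHomogeneous_monomial_sub_monomial ?_
  rw [cubeG, Grading.weightCon_ofVectors]
  exact weightCon_aVec_cycle i

theorem ara_cubeG_le_ten : cubeG.ara (cubeIdeal K) ≤ 10 :=
  Grading.ara_le_card isHomogeneous_cycleBinomial (by rw [cubeIdeal_eq_span_cycleBinomial])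

variable (K) in
/-- The binomials of the six squares, and the sum of those of the four hexagons. -/
noncomputable def squaresAndHexagonSum (i : Option (Fin 6)) : MvPolynomial CubeEdge K :=
  i.elim (∑ k, cycleBinomial K (.inr k)) fun k => cycleBinomial K (.inl k)

theorem radical_cubeIdeal_eq : (cubeIdeal K).radical =
    (Ideal.span (Set.range (squaresAndHexagonSum K))).radical := by
  set J := Ideal.span (Set.range (squaresAndHexagonSum K))
  have hJ (i) : squaresAndHexagonSum K i ∈ J := Ideal.subset_span (Set.mem_range_self i)
  have hhexagon (k : Fin 4) : cycleBinomial K (.inr k) ∈ J.radical :=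
    mem_radical_of_sum_mem_of_mul_mem (a := fun k => cycleBinomial K (.inr k)) (hJ none)
      (fun a b hab => hexagon_mul_hexagon_mem (fun k => hJ (some k)) hab) k
  apply le_antisymm
  · rw [Ideal.radical_le_radical_iff, cubeIdeal_eq_span_cycleBinomial, Ideal.span_le]
    rintro _ ⟨k | k, rfl⟩
    · exact Ideal.le_radical (hJ (some k))
    · exact hhexagon k
  · refine Ideal.radical_mono (Ideal.span_le.2 ?_)
    rintro _ ⟨_ | k, rfl⟩
    · exact (cubeIdeal K).sum_mem (t := Finset.univ) fun k _ =>
        cycleBinomial_mem_cubeIdeal K (.inr k)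
    · exact cycleBinomial_mem_cubeIdeal K _

theorem isHomogeneous_sum_hexagon : cubeF.IsHomogeneous (∑ k, cycleBinomial K (.inr k)) := by
  have hdeg : ∀ k : Fin 4, ∑ e ∈ cyclePos (.inr k), bVec e = ∑ e ∈ cyclePos (.inr 0), bVec e ∧
      ∑ e ∈ cycleNeg (.inr k), bVec e = ∑ e ∈ cyclePos (.inr 0), bVec e := by
    decide
  have hmonomial {s : Finset CubeEdge} (hs : ∑ e ∈ s, bVec e = ∑ e ∈ cyclePos (.inr 0), bVec e) :
      IsWeightedHomogeneous cubeF.gen (monomial (squarefreeExponent s) (1 : K))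
        (weight cubeF.gen (squarefreeExponent (cyclePos (.inr 0)))) := by
    rw [← weightCon_squarefreeExponent_iff, ← Grading.weightCon_ofVectors] at hs
    exact isWeightedHomogeneous_monomial _ _ _ hs
  exact ⟨_, IsWeightedHomogeneous.sum _ _ _ fun k _ =>
    (hmonomial (hdeg k).1).sub (hmonomial (hdeg k).2)⟩

theorem ara_cubeF_le_seven : cubeF.ara (cubeIdeal K) ≤ 7 := by
  refine Grading.ara_le_card (fun i => ?_) radical_cubeIdeal_eq
  obtain _ | k := i
  · exact isHomogeneous_sum_hexagon
  · exact (isHomogeneous_cycleBinomial (.inl k)).of_weightCon_le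
      (Grading.isSpecialization_iff.1 (isSpecialization_cubeF_cubeG (K := K)))

end UpperBounds

section Height

theorem five_le_height_cubeIdeal : 5 ≤ (cubeIdeal K).height := by
  rw [cubeIdeal_eq_toricIdeal]
  let square : Fin 5 → Fin 6 := ![5, 1, 2, 4, 0]
  refine le_height_toricIdeal aVec ![e78, e56, e67, e58, e12]
    (fun i => squarefreeExponent (cyclePos (.inl (square i))))
    (fun i => squarefreeExponent (cycleNeg (.inl (square i))))
    (fun i => weightCon_aVec_cycle _) ?_ ?_ <;>
  · simp only [squarefreeExponent_apply]
    decide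

theorem height_cubeIdeal_le_five : (cubeIdeal K).height ≤ 5 := by
  rw [cubeIdeal_eq_toricIdeal]
  let square : Fin 5 → Fin 6 := ![0, 1, 2, 4, 5]
  refine height_toricIdeal_le_card (fun i => weightCon_aVec_cycle (.inl (square i)))
    fun m n h => ?_
  -- `78` lies in the last of the squares only; then `34`, `56`, `67`, `58` determine the
  -- coefficients of the others.
  let α (e : CubeEdge) : ℤ := m e - n e
  let c : Fin 5 → ℤ := ![α e34, α e56 - α e78, α e67 + α e78, α e58 + α e78, α e78]
  have hα : (fun e => (m e : ℤ) - n e) = ∑ i, c i • fun e =>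
      (squarefreeExponent (cyclePos (.inl (square i))) e : ℤ) -
        squarefreeExponent (cycleNeg (.inl (square i))) e := by
    have hdeg := sum_edgeAt_eq h
    simp only [Fin.forall_fin_succ, Fin.sum_univ_three, forall_const, edgeAt, Matrix.cons_val',
      Matrix.cons_val_fin_one, Matrix.cons_val_zero, Matrix.cons_val_one, Matrix.cons_val,
      Matrix.cons_val_succ] at hdeg
    ext e
    cases e <;>
      simp [Fin.sum_univ_five, squarefreeExponent_apply, square, cyclePos, cycleNeg, c, α] <;>
      omega
  rw [hα]
  exact sum_mem fun i _ => zsmul_mem (AddSubgroup.subset_closure (Set.mem_range_self i)) _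

end Height

section Gradings

/-- The refinement of `cubeF` by the degree at the vertex `1` modulo `r`. -/
def modGrading (r : ℕ) : Grading.{u} CubeEdge :=
  Grading.ofVectors fun e => ULift.up.{u} (bVec e, (aVec e 0 : ZMod r))

theorem weightCon_modGrading_iff {r : ℕ} {m n : CubeEdge →₀ ℕ} :
    weightCon (modGrading.{u} r).gen m n ↔
      weightCon bVec m n ∧ weightCon (fun e => (aVec e 0 : ZMod r)) m n := by
  rw [modGrading, Grading.weightCon_ofVectors, ← weightCon_prodMk_iff]
  have h := weightCon_map_of_injective
    (φ := (AddEquiv.ulift.{0, u} (α := (Fin 4 → ℤ) × ZMod r)).symm.toAddMonoidHom)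
    (AddEquiv.injective _) (fun e : CubeEdge => (bVec e, (aVec e 0 : ZMod r)))
  exact iff_of_eq (congrArg (fun c : AddCon (CubeEdge →₀ ℕ) => c m n) h)

theorem weightCon_modGrading_smul_iff (r k : ℕ) :
    weightCon (modGrading.{u} r).gen (k • (single e15 1 + single e23 2))
      (k • (single e12 2 + single e37 1)) ↔ r ∣ k := by
  have hb : weightCon bVec (single e15 1 + single e23 2) (single e12 2 + single e37 1) := by
    change weight bVec _ = weight bVec _
    simp only [map_add, Finsupp.weight_single]
    decide
  rw [weightCon_modGrading_iff, and_iff_right ((weightCon bVec).nsmul k hb)]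
  change weight _ _ = weight _ _ ↔ _
  have hdeg : aVec e15 0 = 1 ∧ aVec e23 0 = 0 ∧ aVec e12 0 = 1 ∧ aVec e37 0 = 0 := by decide
  obtain ⟨h15, h23, h12, h37⟩ := hdeg
  rw [map_nsmul, map_nsmul, map_add, map_add]
  simp only [Finsupp.weight_single, h15, h23, h12, h37]
  rw [← ZMod.natCast_eq_zero_iff]
  simp [mul_two]

variable {K} in
theorem isSpecialization_modGrading (r : ℕ) :
    Grading.IsSpecialization K cubeF (modGrading.{u} r) ∧
      Grading.IsSpecialization K (modGrading.{u} r) cubeG := by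
  simp only [Grading.isSpecialization_iff, cubeF, cubeG, Grading.weightCon_ofVectors]
  refine ⟨fun m n h => (weightCon_modGrading_iff.1 h).1, fun m n h =>
    weightCon_modGrading_iff.2 ⟨weightCon_aVec_le_weightCon_bVec h, ?_⟩⟩
  exact weightCon_le_weightCon_map
    ((Int.castAddHom (ZMod r)).comp (Pi.evalAddMonoidHom (fun _ : Fin 8 => ℤ) 0)) aVec h

theorem infinite_gradings :
    {c : Quotient (Grading.equivalence.{u} K CubeEdge) | ∃ H : Grading.{u} CubeEdge,
      c = Quotient.mk (Grading.equivalence K CubeEdge) H ∧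
        Grading.IsSpecialization K cubeF H ∧ Grading.IsSpecialization K H cubeG}.Infinite := by
  have hdvd {r s : ℕ} (h : Grading.IsSpecialization K (modGrading.{u} r) (modGrading.{u} s)) :
      r ∣ s :=
    (weightCon_modGrading_smul_iff.{u} r s).1 <|
      Grading.isSpecialization_iff.1 h ((weightCon_modGrading_smul_iff.{u} s s).2 dvd_rfl)
  refine Set.infinite_of_injective_forall_mem
    (f := fun r : ℕ => Quotient.mk (Grading.equivalence.{u} K CubeEdge) (modGrading r))
    (fun r s hrs => ?_) fun r => ⟨modGrading r, rfl, isSpecialization_modGrading r⟩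
  have h := Quotient.exact hrs
  exact Nat.dvd_antisymm (hdvd fun J => (h J).2) (hdvd fun J => (h J).1)

end Gradings

end CubeEdge

open CubeEdge

theorem mainTheorem10 (K : Type v) [Field K] :
    (cubeIdeal K).IsPrime ∧
    cubeIdeal K = RingHom.ker (cubeHom K) ∧
    Grading.IsSpecialization K cubeF cubeG ∧
    cubeG.ara (cubeIdeal K) = 10 ∧
    cubeF.ara (cubeIdeal K) = 7 ∧
    (cubeIdeal K).height = 5 ∧
    (∀ H : Grading.{u} CubeEdge,
      Grading.IsSpecialization K cubeF H → Grading.IsSpecialization K H cubeG →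
        7 ≤ H.ara (cubeIdeal K) ∧ H.ara (cubeIdeal K) ≤ 10 ∧
        ¬ H.IsSetTheoreticCI (cubeIdeal K)) ∧
    {c : Quotient (Grading.equivalence.{u} K CubeEdge) | ∃ H : Grading.{u} CubeEdge,
      c = Quotient.mk (Grading.equivalence K CubeEdge) H ∧
        Grading.IsSpecialization K cubeF H ∧ Grading.IsSpecialization K H cubeG}.Infinite := by
  have hheight : (cubeIdeal K).height = 5 :=
    le_antisymm (height_cubeIdeal_le_five K) (five_le_height_cubeIdeal K)
  refine ⟨cubeIdeal_isPrime K, cubeIdeal_eq_ker_cubeHom K, isSpecialization_cubeF_cubeG,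
    le_antisymm ara_cubeG_le_ten (ten_le_ara_cubeG K),
    le_antisymm ara_cubeF_le_seven (seven_le_ara_cubeF K), hheight, fun H hF hG => ?_,
    infinite_gradings K⟩
  have h7 : 7 ≤ H.ara (cubeIdeal K) := (seven_le_ara_cubeF K).trans (hF.ara_le _)
  refine ⟨h7, (hG.ara_le _).trans ara_cubeG_le_ten, fun hCI => ?_⟩
  rw [(Eq.symm hCI).trans hheight] at h7
  exact absurd h7 (by decide)
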